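/- Let $\mathbb{F}=\mathbb{R}$ or $\mathbb{C}$, let $n\ge 1$, and equip $\mathbb{F}^n$ with its standard inner product. Call a (possibly infinite) relation $R\subseteq\mathbb{F}^n\times\mathbb{F}^n$ a *linorder* if (1) whenever $(v,w)\in R$, $(\tilde v,\tilde w)\in R$ and $w\not\perp\tilde v$, also $(v,\tilde w)\in R$; and (2) $(v,w)\in R$ implies $v\perp w$. A *bi-chain* for $R$ is a sequence $(w_1,v_1,\ldots,w_r,v_r)$ of vectors in $\mathbb{F}^n$, with $r\ge 1$, such that $w_i\not\perp v_i$ for $1\le i\le r$ and $(v_i,w_{i+1})\in R$ for $1\le i<r$. A *decomposition of $\mathbb{F}^n$ into bi-chains* is a finite family of bi-chains whose $v$'s collectively form a basis of $\mathbb{F}^n$ and whose $w$'s collectively form a basis of $\mathbb{F}^n$ (vectors being counted with multiplicity); its *size* is the number of bi-chains in the family. An *antichain* for $R$ is a linear subspace $C\subseteq\mathbb{F}^n$ such that every $(v,w)\in R$ satisfies $v\perp C$ or $w\perp C$. **Theorem (Linear Dilworth's theorem).** Let $n\ge 1$ and let $R\subseteq\mathbb{F}^n\times\mathbb{F}^n$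 be a linorder. Then the minimum size of a decomposition of $\mathbb{F}^n$ into bi-chains for $R$ equals the maximum dimension of an antichain for $R$. -/

import Mathlib

namespace LinDilworth

/-- A linorder: a relation `R` on `𝕜ⁿ` such that
(1) if `(v, w), (v', w') ∈ R` and `w` is not orthogonal to `v'`, then `(v, w') ∈ R`;
(2) if `(v, w) ∈ R`, then `v` is orthogonal to `w`. -/
structure IsLinorder (𝕜 : Type*) [RCLike 𝕜] {n : ℕ}
    (R : Set (EuclideanSpace 𝕜 (Fin n) × EuclideanSpace 𝕜 (Fin n))) : Prop where
  trans : ∀ v w v' w' : EuclideanSpace 𝕜 (Fin n),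
    (v, w) ∈ R → (v', w') ∈ R → inner 𝕜 w v' ≠ 0 → (v, w') ∈ R
  perp : ∀ v w : EuclideanSpace 𝕜 (Fin n), (v, w) ∈ R → inner 𝕜 v w = 0

/-- A bi-chain `(w₁, v₁, …, wᵣ, vᵣ)` for `R`, of length `r ≥ 1`: each `wᵢ` is not orthogonal to
`vᵢ`, and `(vᵢ, wᵢ₊₁) ∈ R` for all consecutive indices. -/
structure BiChain (𝕜 : Type*) [RCLike 𝕜] {n : ℕ}
    (R : Set (EuclideanSpace 𝕜 (Fin n) × EuclideanSpace 𝕜 (Fin n))) where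
  /-- the length `r` -/
  length : ℕ
  length_pos : 0 < length
  /-- the vectors `w₁, …, wᵣ` -/
  w : Fin length → EuclideanSpace 𝕜 (Fin n)
  /-- the vectors `v₁, …, vᵣ` -/
  v : Fin length → EuclideanSpace 𝕜 (Fin n)
  not_perp : ∀ i, inner 𝕜 (w i) (v i) ≠ 0
  step : ∀ i j : Fin length, (i : ℕ) + 1 = j → (v i, w j) ∈ R

/-- The vectors `x k`, indexed by `ι` (so counted with multiplicity), form a basis of `𝕜ⁿ`. -/
def FormBasis (𝕜 : Type*) [RCLike 𝕜] {n : ℕ} {ι : Type*}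
    (x : ι → EuclideanSpace 𝕜 (Fin n)) : Prop :=
  LinearIndependent 𝕜 x ∧ Submodule.span 𝕜 (Set.range x) = ⊤

/-- A family of `c` bi-chains is a decomposition of `𝕜ⁿ` into bi-chains if all their `v`'s
together form a basis and all their `w`'s together form a basis. -/
structure IsDecomposition {𝕜 : Type*} [RCLike 𝕜] {n : ℕ}
    {R : Set (EuclideanSpace 𝕜 (Fin n) × EuclideanSpace 𝕜 (Fin n))} {c : ℕ}
    (B : Fin c → BiChain 𝕜 R) : Prop where
  basis_v : FormBasis 𝕜 (fun p : (j : Fin c) × Fin (B j).length => (B p.1).v p.2)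
  basis_w : FormBasis 𝕜 (fun p : (j : Fin c) × Fin (B j).length => (B p.1).w p.2)

/-- An antichain for `R`: a subspace `C` such that every `(v, w) ∈ R` satisfies `v ⊥ C` or
`w ⊥ C`. -/
def IsAntichainSubspace {𝕜 : Type*} [RCLike 𝕜] {n : ℕ}
    (R : Set (EuclideanSpace 𝕜 (Fin n) × EuclideanSpace 𝕜 (Fin n)))
    (C : Submodule 𝕜 (EuclideanSpace 𝕜 (Fin n))) : Prop :=
  ∀ v w : EuclideanSpace 𝕜 (Fin n), (v, w) ∈ R → v ∈ Cᗮ ∨ w ∈ Cᗮ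

end LinDilworth

/-!
Call a pair of subspaces `(V, W)` a *cover* of `R` if every `(v, w) ∈ R` has `v ∈ V` or `w ∈ W`, and
call `k` pairs of `R` whose first components are linearly independent and whose second components
are linearly independent a *matching* of size `k`. The proof follows the derivation of Dilworth's
theorem from Kőnig's theorem.

* The maximal size of a matching equals the minimal `m` of `dim V + dim W` over covers
  (`exists_matching`). This is the matroid intersection theorem for two linear matroids, over a
  possibly infinite ground set; it is proved by contracting one well-chosen pair at a time.
* A matching of size `m` yields a decomposition into `n - m` bi-chains
  (`exists_decomposition_of_matching`): complete both sides of the matching to bases `a` and `b`. The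
  Gram matrix of `b` against `a` is invertible, so some term of its determinant is nonzero, and this
  permutation links each `b i` to a non-orthogonal `a (τ i)`. The cycles of the permutation, cut at
  the indices outside the matching, are the bi-chains. A cycle inside the matching would, by
  transitivity, put a non-orthogonal pair into `R`.
* A cover `(V, W)` yields the antichain `(V ⊔ W)ᗮ`, of dimension at least `n - dim V - dim W`.
* An antichain of dimension `k` yields a cover with `dim V + dim W ≤ n - k`
  (`exists_cover_of_antichain`), and a decomposition into `c` bi-chains contains a matching of size
  `n - c`, so `k ≤ c` (`finrank_le_of_decomposition`).
-/

namespace LinDilworth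

open Module Submodule

/-! ### Covers, matchings and their duality -/

/-- The pair of subspaces `(V, W)` covers `R` if each `(v, w) ∈ R` has `v ∈ V` or `w ∈ W`. -/
def IsCover {K E F : Type*} [Field K] [AddCommGroup E] [Module K E] [AddCommGroup F] [Module K F]
    (R : Set (E × F)) (V : Submodule K E) (W : Submodule K F) : Prop :=
  ∀ p ∈ R, p.1 ∈ V ∨ p.2 ∈ W

section Duality

variable {K E F : Type*} [Field K] [AddCommGroup E] [Module K E]
  [AddCommGroup F] [Module K F] {R : Set (E × F)}

lemma IsCover.inf_sup {V V' : Submodule K E} {W W' : Submodule K F}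
    (h : IsCover R V W) (h' : IsCover R V' W') : IsCover R (V ⊓ V') (W ⊔ W') := by
  intro p hp
  rcases h p hp with h1 | h1
  · rcases h' p hp with h2 | h2
    · exact Or.inl ⟨h1, h2⟩
    · exact Or.inr (mem_sup_right h2)
  · exact Or.inr (mem_sup_left h1)

lemma IsCover.sup_inf {V V' : Submodule K E} {W W' : Submodule K F}
    (h : IsCover R V W) (h' : IsCover R V' W') : IsCover R (V ⊔ V') (W ⊓ W') := by
  intro p hp
  rcases h p hp with h1 | h1
  · exact Or.inl (mem_sup_left h1)
  · rcases h' p hp with h2 | h2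
    · exact Or.inl (mem_sup_right h2)
    · exact Or.inr ⟨h1, h2⟩

lemma sup_span_range_cons (V : Submodule K E) {k : ℕ} (x : E) (f : Fin k → E) :
    V ⊔ span K (Set.range (Fin.cons x f : Fin (k + 1) → E)) =
      V ⊔ span K {x} ⊔ span K (Set.range f) := by
  rw [Fin.range_cons, Submodule.span_insert, sup_assoc]

variable [FiniteDimensional K E]

lemma finrank_sup_span_singleton_of_notMem {V : Submodule K E} {x : E} (hx : x ∉ V) :
    finrank K ↥(V ⊔ span K {x}) = finrank K V + 1 := by
  have h0 : x ≠ 0 := fun h => hx (h ▸ V.zero_mem)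
  have h1 := Submodule.finrank_sup_add_finrank_inf_eq V (span K {x})
  have h2 : V ⊓ span K {x} = ⊥ :=
    disjoint_iff.1 ((Submodule.disjoint_span_singleton' h0).2 hx)
  rw [h2, finrank_bot, finrank_span_singleton h0] at h1
  exact h1

variable [FiniteDimensional K F]

/-- If all covers above `(V₀, W₀)` have total dimension at least `k + 1` more than `(V₀, W₀)`, then
some pair `e ∈ R` can be contracted: it lies outside `V₀` and `W₀`, and no cover attaining this bound
contains both components of `e`. Covers attaining the bound are closed under `(⊓, ⊔)`, by
modularity; `e` is found from such a cover with `V ≠ V₀` as small as possible. -/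
lemma exists_contractible {k : ℕ} {V₀ : Submodule K E} {W₀ : Submodule K F}
    (h : ∀ V W, V₀ ≤ V → W₀ ≤ W → IsCover R V W →
      k + 1 + finrank K V₀ + finrank K W₀ ≤ finrank K V + finrank K W) :
    ∃ e ∈ R, e.1 ∉ V₀ ∧ e.2 ∉ W₀ ∧ ∀ V W, V₀ ≤ V → W₀ ≤ W → IsCover R V W →
      e.1 ∈ V → e.2 ∈ W → k + 1 + finrank K V₀ + finrank K W₀ < finrank K V + finrank K W := by
  classical
  by_cases hT : ∃ r V W, V₀ < V ∧ W₀ ≤ W ∧ IsCover R V W ∧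
      finrank K V + finrank K W = k + 1 + finrank K V₀ + finrank K W₀ ∧ finrank K V = r
  · obtain ⟨V, W, hV, hW, hc, ht, hr⟩ := Nat.find_spec hT
    have hmin := fun s hs => Nat.find_min hT (m := s) hs
    rw [← hr] at hmin
    have hlt := Submodule.finrank_lt_finrank_of_lt hV
    obtain ⟨e, he, he1, he2⟩ : ∃ e ∈ R, e.1 ∉ V₀ ∧ e.2 ∉ W := by
      by_contra! hcon
      have := h V₀ W le_rfl hW (fun p hp => or_iff_not_imp_left.2 (hcon p hp))
      omega
    refine ⟨e, he, he1, fun h2 => he2 (hW h2), ?_⟩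
    intro V' W' hV' hW' hc' h1 h2
    by_contra hge
    have heV : e.1 ∈ V := (hc e he).resolve_right he2
    have hI := h (V ⊓ V') (W ⊔ W') (le_inf hV.le hV') (hW.trans le_sup_left) (hc.inf_sup hc')
    have hS := h (V ⊔ V') (W ⊓ W') (hV.le.trans le_sup_left) (le_inf hW hW') (hc.sup_inf hc')
    have e1 := Submodule.finrank_sup_add_finrank_inf_eq V V'
    have e2 := Submodule.finrank_sup_add_finrank_inf_eq W W'
    -- `e.1 ∈ V ⊓ V'`, so minimality of `V` gives `V ⊓ V' = V`; the bound then forces `W ⊔ W' = W`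
    have hlt' : V₀ < V ⊓ V' :=
      lt_of_le_of_ne (le_inf hV.le hV') (fun hh => he1 (hh ▸ ⟨heV, h1⟩))
    have hVV : finrank K V ≤ finrank K ↥(V ⊓ V') := by
      by_contra! hcon
      exact hmin _ hcon ⟨V ⊓ V', W ⊔ W', hlt', hW.trans le_sup_left, hc.inf_sup hc',
        by omega, rfl⟩
    have hWW : finrank K ↥(W ⊔ W') ≤ finrank K W := by omega
    have hWeq : W = W ⊔ W' := Submodule.eq_of_le_of_finrank_le le_sup_left hWW
    exact he2 (hWeq ▸ mem_sup_right h2)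
  · obtain ⟨e, he, he1, he2⟩ : ∃ e ∈ R, e.1 ∉ V₀ ∧ e.2 ∉ W₀ := by
      by_contra! hcon
      have := h V₀ W₀ le_rfl le_rfl (fun p hp => or_iff_not_imp_left.2 (hcon p hp))
      omega
    refine ⟨e, he, he1, he2, fun V W hV hW hc h1 h2 => ?_⟩
    refine lt_of_le_of_ne (h V W hV hW hc) (fun heq => hT ?_)
    exact ⟨_, V, W, lt_of_le_of_ne hV (fun hh => he1 (hh ▸ h1)), hW, hc, heq.symm, rfl⟩

/-- The duality of covers and matchings relative to `(V₀, W₀)`: the matching found is independent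
modulo `V₀` and modulo `W₀`. -/
lemma exists_matching_relative (k : ℕ) : ∀ (V₀ : Submodule K E) (W₀ : Submodule K F),
    (∀ V W, V₀ ≤ V → W₀ ≤ W → IsCover R V W →
      k + finrank K V₀ + finrank K W₀ ≤ finrank K V + finrank K W) →
    ∃ (f : Fin k → E) (g : Fin k → F), (∀ i, (f i, g i) ∈ R) ∧
      finrank K ↥(V₀ ⊔ span K (Set.range f)) = finrank K V₀ + k ∧
      finrank K ↥(W₀ ⊔ span K (Set.range g)) = finrank K W₀ + k := by
  induction k with
  | zero =>
    intro V₀ W₀ _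
    refine ⟨Fin.elim0, Fin.elim0, fun i => i.elim0, ?_, ?_⟩ <;>
      rw [Set.range_eq_empty, span_empty, sup_bot_eq, add_zero]
  | succ k ih =>
    intro V₀ W₀ h
    obtain ⟨e, he, he1, he2, hstrict⟩ := exists_contractible h
    have d1 := finrank_sup_span_singleton_of_notMem he1
    have d2 := finrank_sup_span_singleton_of_notMem he2
    obtain ⟨f, g, hfg, hf, hg⟩ := ih (V₀ ⊔ span K {e.1}) (W₀ ⊔ span K {e.2}) (by
      intro V W hV hW hc
      have := hstrict V W (le_sup_left.trans hV) (le_sup_left.trans hW) hc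
        (hV (mem_sup_right (mem_span_singleton_self _)))
        (hW (mem_sup_right (mem_span_singleton_self _)))
      omega)
    refine ⟨Fin.cons e.1 f, Fin.cons e.2 g, ?_, ?_, ?_⟩
    · intro i
      refine Fin.cases ?_ (fun j => ?_) i
      · simpa using he
      · simpa using hfg j
    · rw [sup_span_range_cons, hf, d1]; omega
    · rw [sup_span_range_cons, hg, d2]; omega

/-- Matroid intersection for linear matroids: if every cover of `R` has total dimension at least
`k`, then `R` contains `k` pairs with independent first and independent second components. -/
theorem exists_matching (k : ℕ)
    (h : ∀ (V : Submodule K E) (W : Submodule K F), IsCover R V W →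
      k ≤ finrank K V + finrank K W) :
    ∃ (f : Fin k → E) (g : Fin k → F), (∀ i, (f i, g i) ∈ R) ∧
      LinearIndependent K f ∧ LinearIndependent K g := by
  obtain ⟨f, g, hfg, hf, hg⟩ := exists_matching_relative (R := R) k (⊥ : Submodule K E)
    (⊥ : Submodule K F) (by simpa using fun V W hc => h V W hc)
  refine ⟨f, g, hfg, ?_, ?_⟩
  · rw [bot_sup_eq, finrank_bot, zero_add] at hf
    rw [linearIndependent_iff_card_eq_finrank_span, Fintype.card_fin]
    exact hf.symm
  · rw [bot_sup_eq, finrank_bot, zero_add] at hg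
    rw [linearIndependent_iff_card_eq_finrank_span, Fintype.card_fin]
    exact hg.symm

/-- Weak duality: a matching is no larger than a cover. -/
lemma card_le_of_cover {ι : Type*} [Fintype ι] {f : ι → E} {g : ι → F}
    (hfg : ∀ i, (f i, g i) ∈ R) (hf : LinearIndependent K f) (hg : LinearIndependent K g)
    {V : Submodule K E} {W : Submodule K F} (hc : IsCover R V W) :
    Fintype.card ι ≤ finrank K V + finrank K W := by
  classical
  rw [← Fintype.card_congr (Equiv.sumCompl (fun i => f i ∈ V)), Fintype.card_sum]
  refine add_le_add ?_ ?_
  · have h1 : LinearIndependent K (fun i : {i // f i ∈ V} => (⟨f i, i.2⟩ : V)) :=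
      LinearIndependent.of_comp V.subtype (hf.comp _ Subtype.val_injective)
    exact h1.fintype_card_le_finrank
  · have h1 : LinearIndependent K
        (fun i : {i // ¬ f i ∈ V} => (⟨g i, (hc _ (hfg i)).resolve_left i.2⟩ : W)) :=
      LinearIndependent.of_comp W.subtype (hg.comp _ Subtype.val_injective)
    exact h1.fintype_card_le_finrank

end Duality

/-! ### Cutting the cycles of a permutation -/

/-- If every cycle of `τ` meets the right summand, then cutting the cycles there yields one path per
element `x` of the right summand, starting at `x` and then staying in the left summand; `r x` is
the first return time of `x`. The paths partition the index set. -/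
lemma exists_paths {α β : Type*} [Finite α] [Finite β] (τ : Equiv.Perm (α ⊕ β))
    (h : ∀ i, ∃ s : ℕ, ((τ⁻¹ ^ s) i).isRight) :
    ∃ r : β → ℕ, (∀ x, 0 < r x) ∧
      (∀ x t, 0 < t → t < r x → ∃ y, (τ ^ t) (Sum.inr x) = Sum.inl y) ∧
      Function.Bijective
        (fun p : (x : β) × Fin (r x) => (τ ^ (p.2 : ℕ)) (Sum.inr p.1)) := by
  classical
  have hex : ∀ x : β, ∃ t : ℕ, 0 < t ∧ ((τ ^ t) (Sum.inr x)).isRight := fun x =>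
    ⟨orderOf τ, orderOf_pos τ, by simp [pow_orderOf_eq_one]⟩
  have hleft : ∀ x t, 0 < t → t < Nat.find (hex x) →
      ∃ y, (τ ^ t) (Sum.inr x) = Sum.inl y := by
    intro x t h0 ht
    have := Nat.find_min (hex x) ht
    rw [← Sum.isLeft_iff, ← Sum.not_isRight]
    exact fun hh => this ⟨h0, hh⟩
  refine ⟨fun x => Nat.find (hex x), fun x => (Nat.find_spec (hex x)).1, hleft, ?_, ?_⟩
  · have key : ∀ (x x' : β) (t t' : ℕ), t ≤ t' → t' < Nat.find (hex x') →
        (τ ^ t) (Sum.inr x) = (τ ^ t') (Sum.inr x') → x = x' ∧ t = t' := by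
      intro x x' t t' hle ht' heq
      obtain ⟨q, rfl⟩ := Nat.exists_eq_add_of_le hle
      rw [pow_add, Equiv.Perm.mul_apply] at heq
      have heq := (τ ^ t).injective heq
      rcases Nat.eq_zero_or_pos q with rfl | hq
      · exact ⟨by simpa using heq, rfl⟩
      · obtain ⟨y, hy⟩ := hleft x' q hq (by omega)
        rw [hy] at heq
        cases heq
    rintro ⟨x, t⟩ ⟨x', t'⟩ heq
    have : x = x' ∧ (t : ℕ) = t' := by
      rcases le_total (t : ℕ) t' with hle | hle
      · exact key x x' t t' hle t'.2 heq
      · have := key x' x t' t hle t.2 heq.symm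
        exact ⟨this.1.symm, this.2.symm⟩
    obtain ⟨rfl, h2⟩ := this
    rw [Fin.ext h2]
  · intro i
    obtain ⟨x, hx⟩ := Sum.isRight_iff.1 (Nat.find_spec (h i))
    have hi : ∀ q p, q + p = Nat.find (h i) → (τ ^ q) (Sum.inr x) = (τ⁻¹ ^ p) i := by
      intro q p hqp
      rw [← hx, ← hqp, pow_add, Equiv.Perm.mul_apply, inv_pow τ q]
      exact (τ ^ q).apply_symm_apply _
    refine ⟨⟨x, ⟨Nat.find (h i), ?_⟩⟩, ?_⟩
    · by_contra! hcon
      -- otherwise the path from `x` would return to the right summand after its last visit before `i`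
      have hs := Nat.find_spec (hex x)
      obtain ⟨p, hp⟩ := Nat.exists_eq_add_of_le hcon
      refine Nat.find_min (h i) (m := p) (by omega) ?_
      rw [← hi _ p hp.symm]
      exact hs.2
    · simpa using hi (Nat.find (h i)) 0 rfl

/-! ### From matchings to bi-chains -/

section Chains

variable {𝕜 : Type*} [RCLike 𝕜] {n : ℕ}

local notation "𝔼" => EuclideanSpace 𝕜 (Fin n)

/-- A linearly independent family of `m` vectors extends to a basis by `n - m` further vectors. -/
lemma exists_basis_extension {m d : ℕ} (hmd : m + d = n) {f : Fin m → 𝔼}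
    (hf : LinearIndependent 𝕜 f) :
    ∃ a : Basis (Fin m ⊕ Fin d) 𝕜 𝔼, ∀ i, a (Sum.inl i) = f i := by
  obtain ⟨Q, hQ⟩ := Submodule.exists_isCompl (span 𝕜 (Set.range f))
  have hfr : finrank 𝕜 Q = d := by
    have h1 := Submodule.finrank_add_eq_of_isCompl hQ
    rw [finrank_span_eq_card hf, Fintype.card_fin, finrank_euclideanSpace_fin] at h1
    exact Nat.add_left_cancel (h1.trans hmd.symm)
  have hli : LinearIndependent 𝕜
      (Sum.elim f (fun i => ((finBasisOfFinrankEq 𝕜 Q hfr i : Q) : 𝔼))) := by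
    refine hf.sum_type ((finBasisOfFinrankEq 𝕜 Q hfr).linearIndependent.map' Q.subtype
      (Submodule.ker_subtype Q)) (hQ.disjoint.mono_right ?_)
    rw [Submodule.span_le]
    rintro _ ⟨i, rfl⟩
    exact (finBasisOfFinrankEq 𝕜 Q hfr i).2
  have hspan := hli.span_eq_top_of_card_eq_finrank' (by simp [hmd])
  exact ⟨Basis.mk hli hspan.ge, fun i => by simp⟩

/-- Some term of the nonvanishing Gram determinant of two bases is nonzero. -/
lemma exists_perm_inner_ne_zero {I : Type*} [Fintype I] (a b : Basis I 𝕜 𝔼) :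
    ∃ τ : Equiv.Perm I, ∀ i, inner 𝕜 (b i) (a (τ i)) ≠ 0 := by
  classical
  have hdet : (Matrix.of fun j i => inner 𝕜 (b i) (a j)).det ≠ 0 := by
    intro h0
    obtain ⟨x, hx, hx0⟩ := Matrix.exists_vecMul_eq_zero_iff.2 h0
    have hz : ∑ j, x j • a j = 0 := by
      refine InnerProductSpace.ext_inner_left_basis b (fun i => ?_)
      have := congrFun hx0 i
      simpa [Matrix.vecMul, dotProduct, inner_sum, inner_smul_right] using this
    exact hx (funext (Fintype.linearIndependent_iff.1 a.linearIndependent x hz))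
  rw [Matrix.det_apply] at hdet
  obtain ⟨τ, -, hτ⟩ := Finset.exists_ne_zero_of_sum_ne_zero hdet
  refine ⟨τ, fun i => ?_⟩
  have h2 : ∏ i, inner 𝕜 (b i) (a (τ i)) ≠ 0 := by
    intro hh
    exact hτ (by simp [hh])
  exact Finset.prod_ne_zero_iff.1 h2 i (Finset.mem_univ i)

lemma formBasis_of_basis {I J : Type*} (a : Basis I 𝕜 𝔼) (e : J ≃ I) :
    FormBasis 𝕜 (fun j => a (e j)) := by
  refine ⟨a.linearIndependent.comp e e.injective, ?_⟩
  rw [← a.span_eq]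
  congr 1
  exact e.surjective.range_comp a

/-- The indices of the matching contain no cycle of the linking permutation `τ`: going backwards
along a cycle through `i`, transitivity would give `(a (τ i), b i) ∈ R`, but these vectors are not
orthogonal. -/
lemma exists_pow_isRight {R : Set (𝔼 × 𝔼)} (hR : IsLinorder 𝕜 R) {α β : Type*} [Finite α] [Finite β]
    {a b : α ⊕ β → 𝔼} (hab : ∀ k, (a (Sum.inl k), b (Sum.inl k)) ∈ R)
    {τ : Equiv.Perm (α ⊕ β)} (hτ : ∀ i, inner 𝕜 (b i) (a (τ i)) ≠ 0) (i : α ⊕ β) :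
    ∃ s : ℕ, ((τ⁻¹ ^ s) i).isRight := by
  by_contra! hcon
  have hl : ∀ s : ℕ, (a ((τ⁻¹ ^ s) i), b ((τ⁻¹ ^ s) i)) ∈ R := by
    intro s
    obtain ⟨y, hy⟩ := Sum.isLeft_iff.1 (Sum.not_isRight.1 (hcon s))
    rw [hy]
    exact hab y
  have hall : ∀ s : ℕ, (a ((τ⁻¹ ^ s) i), b i) ∈ R := by
    intro s
    induction s with
    | zero => simpa using hl 0
    | succ s ih =>
      refine hR.trans _ _ _ _ (hl (s + 1)) ih ?_
      have := hτ ((τ⁻¹ ^ (s + 1)) i)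
      rw [pow_succ', Equiv.Perm.mul_apply] at this ⊢
      rwa [show τ (τ⁻¹ ((τ⁻¹ ^ s) i)) = (τ⁻¹ ^ s) i from τ.apply_symm_apply _] at this
  have hone : (τ⁻¹ ^ (orderOf τ⁻¹ - 1)) = τ := by
    have h1 : τ⁻¹ ^ (orderOf τ⁻¹ - 1) * τ⁻¹ = 1 := by
      rw [← pow_succ, Nat.sub_add_cancel (orderOf_pos _), pow_orderOf_eq_one]
    rwa [mul_inv_eq_one] at h1
  have := hall (orderOf τ⁻¹ - 1)
  rw [hone] at this
  exact hτ i (inner_eq_zero_symm.1 (hR.perp _ _ this))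

/-- The index sequence `x, τ x, τ² x, …` starting at an index `x` outside the matching, until it leaves
the matching again, gives the bi-chain `b x, a (τ x), b (τ x), a (τ² x), …`. -/
lemma exists_decomposition_of_matching {R : Set (𝔼 × 𝔼)} (hR : IsLinorder 𝕜 R) {m d : ℕ}
    (hmd : m + d = n) {f g : Fin m → 𝔼} (hfg : ∀ i, (f i, g i) ∈ R)
    (hf : LinearIndependent 𝕜 f) (hg : LinearIndependent 𝕜 g) :
    ∃ B : Fin d → BiChain 𝕜 R, IsDecomposition B := by
  obtain ⟨a, ha⟩ := exists_basis_extension hmd hf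
  obtain ⟨b, hb⟩ := exists_basis_extension hmd hg
  obtain ⟨τ, hτ⟩ := exists_perm_inner_ne_zero a b
  have hab : ∀ k, (a (Sum.inl k), b (Sum.inl k)) ∈ R := by
    intro k
    rw [ha, hb]
    exact hfg k
  obtain ⟨r, hr0, hrl, hbij⟩ := exists_paths τ (exists_pow_isRight hR hab hτ)
  refine ⟨fun x =>
    { length := r x
      length_pos := hr0 x
      w := fun t => b ((τ ^ (t : ℕ)) (Sum.inr x))
      v := fun t => a (τ ((τ ^ (t : ℕ)) (Sum.inr x)))
      not_perp := fun t => hτ _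
      step := ?_ }, ?_, ?_⟩
  · intro i j hij
    obtain ⟨y, hy⟩ := hrl x j (by omega) j.2
    rw [← Equiv.Perm.mul_apply, ← pow_succ', hij, hy]
    exact hab y
  · exact formBasis_of_basis a ((Equiv.ofBijective _ hbij).trans τ)
  · exact formBasis_of_basis b (Equiv.ofBijective _ hbij)

/-! ### Antichains -/

lemma isAntichainSubspace_of_cover {R : Set (𝔼 × 𝔼)} {V W : Submodule 𝕜 𝔼} (hc : IsCover R V W) :
    IsAntichainSubspace R (V ⊔ W)ᗮ := by
  intro v w hvw
  rw [Submodule.orthogonal_orthogonal]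
  exact (hc _ hvw).imp (fun h => mem_sup_left h) (fun h => mem_sup_right h)

/-- Take `V` spanned by the `v` with `(v, w) ∈ R` for some `w` not orthogonal to `C`, the vectors
strictly below the antichain, and let `W` take care of the remaining pairs. By transitivity `W` is
orthogonal to `V`, and both lie in `Cᗮ`. -/
lemma exists_cover_of_antichain {R : Set (𝔼 × 𝔼)} (hR : IsLinorder 𝕜 R) {C : Submodule 𝕜 𝔼}
    (hC : IsAntichainSubspace R C) :
    ∃ V W : Submodule 𝕜 𝔼, IsCover R V W ∧
      finrank 𝕜 V + finrank 𝕜 W + finrank 𝕜 C ≤ n := by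
  set V : Submodule 𝕜 𝔼 := span 𝕜 {v | ∃ w, (v, w) ∈ R ∧ w ∉ Cᗮ} with hVdef
  set W : Submodule 𝕜 𝔼 := span 𝕜 {w | ∃ v, (v, w) ∈ R ∧ v ∉ V} with hWdef
  have hcov : IsCover R V W := fun p hp =>
    or_iff_not_imp_left.2 (fun h => subset_span ⟨p.1, hp, h⟩)
  have hVC : V ≤ Cᗮ := by
    rw [hVdef, span_le]
    rintro v ⟨w, hvw, hw⟩
    exact (hC v w hvw).resolve_right hw
  have hWC : W ≤ Cᗮ := by
    rw [hWdef, span_le]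
    rintro w ⟨v, hvw, hv⟩
    by_contra hw
    exact hv (subset_span ⟨w, hvw, hw⟩)
  have hVW : V ⟂ W := by
    rw [hVdef, hWdef, Submodule.isOrtho_span]
    rintro v ⟨w, hvw, hw⟩ w' ⟨v', hvw', hv'⟩
    by_contra hne
    refine hv' (subset_span ⟨w, hR.trans v' w' v w hvw' hvw ?_, hw⟩)
    exact fun h0 => hne (inner_eq_zero_symm.1 h0)
  refine ⟨V, W, hcov, ?_⟩
  have h1 := Submodule.finrank_sup_add_finrank_inf_eq V W
  rw [hVW.disjoint.eq_bot, finrank_bot] at h1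
  have h2 := Submodule.finrank_mono (sup_le hVC hWC)
  have h3 := Submodule.finrank_add_finrank_orthogonal C
  rw [finrank_euclideanSpace_fin] at h3
  omega

/-- Weak duality: an antichain gives a small cover, which bounds the matching formed by the
consecutive pairs of the bi-chains. -/
lemma finrank_le_of_decomposition {R : Set (𝔼 × 𝔼)} (hR : IsLinorder 𝕜 R) {C : Submodule 𝕜 𝔼}
    (hC : IsAntichainSubspace R C) {c : ℕ} {B : Fin c → BiChain 𝕜 R} (hB : IsDecomposition B) :
    finrank 𝕜 C ≤ c := by
  obtain ⟨V, W, hcov, hdim⟩ := exists_cover_of_antichain hR hC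
  -- the `n - c` consecutive pairs are indexed by all positions but the last in each bi-chain
  let lo : ((j : Fin c) × Fin ((B j).length - 1)) → ((j : Fin c) × Fin (B j).length) :=
    fun p => ⟨p.1, ⟨p.2, by omega⟩⟩
  let hi : ((j : Fin c) × Fin ((B j).length - 1)) → ((j : Fin c) × Fin (B j).length) :=
    fun p => ⟨p.1, ⟨p.2 + 1, by omega⟩⟩
  have hlo : Function.Injective lo := by
    rintro ⟨j, t⟩ ⟨j', t'⟩ h
    obtain rfl : j = j' := congrArg Sigma.fst h
    have h2 := Fin.mk.inj_iff.1 (eq_of_heq (Sigma.mk.inj_iff.1 h).2)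
    exact congrArg (Sigma.mk j) (Fin.ext h2)
  have hhi : Function.Injective hi := by
    rintro ⟨j, t⟩ ⟨j', t'⟩ h
    obtain rfl : j = j' := congrArg Sigma.fst h
    have h2 := Fin.mk.inj_iff.1 (eq_of_heq (Sigma.mk.inj_iff.1 h).2)
    exact congrArg (Sigma.mk j) (Fin.ext (Nat.succ_injective h2))
  have hcard : Fintype.card ((j : Fin c) × Fin ((B j).length - 1)) ≤
      finrank 𝕜 V + finrank 𝕜 W :=
    card_le_of_cover (f := fun p => (B (lo p).1).v (lo p).2) (g := fun p => (B (hi p).1).w (hi p).2)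
      (fun p => (B p.1).step _ _ rfl)
      (hB.basis_v.1.comp lo hlo) (hB.basis_w.1.comp hi hhi) hcov
  have hn : ∑ j, (B j).length = n := by
    have := finrank_eq_card_basis (Basis.mk hB.basis_v.1 hB.basis_v.2.ge)
    simpa using this.symm
  have hsum : ∑ j, ((B j).length - 1) + c = n := by
    have h1 : ∑ j, ((B j).length - 1 + 1) = n := by
      exact (Finset.sum_congr rfl (fun j _ => Nat.sub_add_cancel (B j).length_pos)).trans hn
    simpa [Finset.sum_add_distrib] using h1
  simp only [Fintype.card_sigma, Fintype.card_fin] at hcard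
  omega

end Chains

end LinDilworth

theorem theorem1p12 {𝕜 : Type*} [RCLike 𝕜] (n : ℕ) (hn : 1 ≤ n)
    (R : Set (EuclideanSpace 𝕜 (Fin n) × EuclideanSpace 𝕜 (Fin n)))
    (hR : LinDilworth.IsLinorder 𝕜 R) :
    ∃ d : ℕ,
      IsLeast {c : ℕ | ∃ B : Fin c → LinDilworth.BiChain 𝕜 R, LinDilworth.IsDecomposition B} d ∧
      IsGreatest {k : ℕ | ∃ C : Submodule 𝕜 (EuclideanSpace 𝕜 (Fin n)),
        LinDilworth.IsAntichainSubspace R C ∧ Module.finrank 𝕜 C = k} d := by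
  classical
  have hex : ∃ m : ℕ, ∃ V W : Submodule 𝕜 (EuclideanSpace 𝕜 (Fin n)),
      LinDilworth.IsCover R V W ∧ Module.finrank 𝕜 V + Module.finrank 𝕜 W = m :=
    ⟨_, ⊤, ⊥, fun _ _ => Or.inl trivial, rfl⟩
  obtain ⟨m, ⟨V, W, hc, hm⟩, hmin⟩ : ∃ m : ℕ,
      (∃ V W : Submodule 𝕜 (EuclideanSpace 𝕜 (Fin n)),
        LinDilworth.IsCover R V W ∧ Module.finrank 𝕜 V + Module.finrank 𝕜 W = m) ∧
      ∀ V W : Submodule 𝕜 (EuclideanSpace 𝕜 (Fin n)),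
        LinDilworth.IsCover R V W → m ≤ Module.finrank 𝕜 V + Module.finrank 𝕜 W :=
    ⟨Nat.find hex, Nat.find_spec hex, fun V W h => Nat.find_min' hex ⟨V, W, h, rfl⟩⟩
  have hmn : m ≤ n := by
    simpa using hmin ⊤ ⊥ (fun _ _ => Or.inl trivial)
  obtain ⟨f, g, hfg, hf, hg⟩ := LinDilworth.exists_matching m hmin
  obtain ⟨B, hB⟩ :=
    LinDilworth.exists_decomposition_of_matching hR (Nat.add_sub_cancel' hmn) hfg hf hg
  have hanti := LinDilworth.isAntichainSubspace_of_cover hc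
  have hfr : Module.finrank 𝕜 ↥(V ⊔ W)ᗮ = n - m := by
    refine le_antisymm (LinDilworth.finrank_le_of_decomposition hR hanti hB) ?_
    have h1 := Submodule.finrank_add_finrank_orthogonal (V ⊔ W)
    have h2 := Submodule.finrank_add_le_finrank_add_finrank V W
    rw [finrank_euclideanSpace_fin] at h1
    omega
  refine ⟨n - m, ⟨⟨B, hB⟩, ?_⟩, ⟨⟨_, hanti, hfr⟩, ?_⟩⟩
  · rintro c ⟨B', hB'⟩
    rw [← hfr]
    exact LinDilworth.finrank_le_of_decomposition hR hanti hB'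
  · rintro k ⟨C, hC, rfl⟩
    exact LinDilworth.finrank_le_of_decomposition hR hC hB
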